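/- Let $A=(A_0,A_1,\dots,A_n)$, $n\ge 0$, be a near-edge, that is, a finite sequence of points of $\mathbb{R}^2$ with strictly increasing $x$-coordinates and no three collinear. An edge of $A$ is a segment joining two distinct points of $A$; a set of edges is non-intersecting if any two distinct edges in it have no common point except possibly a common endpoint; a triangulation of $A$ is a maximal non-intersecting set of edges. A monotone polyline is a polyline $A_{i_0}A_{i_1}\cdots A_{i_p}$ with $0=i_0<i_1<\dots<i_p=n$; $p$ is its number of segments. Let $U$ and $L$ be monotone polylines such that $L$ is nowhere strictly above $U$ and every point of $A$ lies (weakly) between $L$ and $U$. A partial triangulation with roof $U$ and floor $L$ is a set $T$ of edges that contains all segments of $U$ and of $L$ and is a maximal non-intersecting subset of the set of edges of $A$ lying between $L$ and $U$. The set $T$ determines $U$ and $L$. Define the joint triangulation polynomial $$a^{yu}_A(y,u)=\sum_T y^{|U|}u^{|L|}\in\mathbb{Q}[y,u],$$ the sum being over all partial triangulations $T$, where $|U|$ and $|L|$ are the numbers of segments of the roof and of the floor of $T$. If the upper hull of $A$ (the upper boundary of its convex hull) has $i$ edges and the lower hull of $A$ has $j$ edges, then the number of triangulations of $A$ is the coefficient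 $$[y^iu^j]\,a^{yu}_A(y,u).$$ Suppose moreover that $A$ is a chain, that is, every edge $A_kA_{k+1}$ ($0\le k<n$) belongs to every triangulation of $A$. Let $t_A(y)=\sum_m t_m y^m$, where $t_m$ is the number of upper triangulations of $A$ with $m$ segments, that is, of partial triangulations with floor $A_0A_1\cdots A_n$ and a roof with $m$ segments; and let $t^*_A=t_{\overline A}$, where $\overline A$ is the image of $A$ under $(x,y)\mapsto(x,-y)$. Then $$a^{yu}_A(y,u)=t_A(y)\,t^*_A(u),$$ and the number of triangulations of $A$ equals $\bigl([y^i]\,t_A(y)\bigr)\cdot\bigl([u^j]\,t^*_A(u)\bigr)$. -/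

import Mathlib

/-- A standalone near-edge with `n + 1` points: points of the plane in general position
(no three collinear) listed in strictly increasing order of `x`-coordinate. -/
structure NearEdge (n : ℕ) where
  /-- The points, from left to right. -/
  pt : Fin (n + 1) → ℝ × ℝ
  strictMono_fst : StrictMono fun k => (pt k).1
  general_position : ∀ i j k : Fin (n + 1), i < j → j < k →
    ¬ Collinear ℝ {pt i, pt j, pt k}

/-- The set `X` is nowhere strictly above the set `Y`: on each vertical line,
no point of `X` is strictly above a point of `Y`. -/
def LiesBelow (X Y : Set (ℝ × ℝ)) : Prop :=
  ∀ p ∈ X, ∀ q ∈ Y, p.1 = q.1 → p.2 ≤ q.2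

namespace NearEdge

variable {n : ℕ}

/-! ### Edges and triangulations of the point set -/

/-- All edges of the point set: the pair `(i, j)` with `i < j` is the edge joining the points
number `i` and `j`. -/
def allEdges (n : ℕ) : Finset (Fin (n + 1) × Fin (n + 1)) :=
  Finset.univ.filter fun e => e.1 < e.2

/-- The line segment of an edge, endpoints included. -/
def seg (A : NearEdge n) (e : Fin (n + 1) × Fin (n + 1)) : Set (ℝ × ℝ) :=
  segment ℝ (A.pt e.1) (A.pt e.2)

/-- A set of edges is non-intersecting if distinct edges have no common point
apart from a possible common endpoint. -/
def NonCrossing (A : NearEdge n) (T : Finset (Fin (n + 1) × Fin (n + 1))) : Prop :=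
  ∀ e ∈ T, ∀ f ∈ T, e ≠ f →
    Disjoint (openSegment ℝ (A.pt e.1) (A.pt e.2)) (openSegment ℝ (A.pt f.1) (A.pt f.2))

/-- A triangulation: a maximal non-intersecting set of edges. -/
def IsTriangulation (A : NearEdge n) (T : Finset (Fin (n + 1) × Fin (n + 1))) : Prop :=
  Maximal (fun S => S ⊆ allEdges n ∧ A.NonCrossing S) T

/-- The number of triangulations. -/
noncomputable def numTriangulations (A : NearEdge n) : ℕ :=
  {T | A.IsTriangulation T}.ncard

/-! ### Upper and lower hull -/

open Classical in
/-- The edges of the upper hull: those lying on the upper boundary of the convex hull. -/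
noncomputable def upperHullEdges (A : NearEdge n) : Finset (Fin (n + 1) × Fin (n + 1)) :=
  (allEdges n).filter fun e => LiesBelow (convexHull ℝ (Set.range A.pt)) (A.seg e)

open Classical in
/-- The edges of the lower hull: those lying on the lower boundary of the convex hull. -/
noncomputable def lowerHullEdges (A : NearEdge n) : Finset (Fin (n + 1) × Fin (n + 1)) :=
  (allEdges n).filter fun e => LiesBelow (A.seg e) (convexHull ℝ (Set.range A.pt))

/-! ### Monotone polylines -/

/-- A monotone polyline is given by the set of its vertices, visited from left to right;
it is required to contain the first and the last point. -/
def IsMonotonePolyline (U : Finset (Fin (n + 1))) : Prop :=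
  0 ∈ U ∧ Fin.last n ∈ U

/-- The segments of a monotone polyline: pairs of consecutive vertices. -/
def polyEdges (U : Finset (Fin (n + 1))) : Finset (Fin (n + 1) × Fin (n + 1)) :=
  Finset.univ.filter fun e => e.1 ∈ U ∧ e.2 ∈ U ∧ e.1 < e.2 ∧ ∀ m ∈ U, ¬ (e.1 < m ∧ m < e.2)

/-- The polyline as a subset of the plane: its vertices and its segments. -/
def carrier (A : NearEdge n) (U : Finset (Fin (n + 1))) : Set (ℝ × ℝ) :=
  A.pt '' U ∪ ⋃ e ∈ polyEdges U, A.seg e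

open Classical in
/-- The edges lying in the region between the lower polyline `L` and the upper polyline `U`. -/
noncomputable def edgesBetween (A : NearEdge n) (U L : Finset (Fin (n + 1))) :
    Finset (Fin (n + 1) × Fin (n + 1)) :=
  (allEdges n).filter fun e =>
    LiesBelow (A.carrier L) (A.seg e) ∧ LiesBelow (A.seg e) (A.carrier U)

theorem mem_edgesBetween {A : NearEdge n} {U L : Finset (Fin (n + 1))}
    {e : Fin (n + 1) × Fin (n + 1)} : e ∈ A.edgesBetween U L ↔
      e ∈ allEdges n ∧ LiesBelow (A.carrier L) (A.seg e) ∧ LiesBelow (A.seg e) (A.carrier U) := by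
  classical
  simp [edgesBetween]

/-- `T` triangulates the region between the roof `U` and the floor `L`, where all points of the
near-edge lie between `U` and `L`. -/
structure IsPartialTriangulation (A : NearEdge n) (U L : Finset (Fin (n + 1)))
    (T : Finset (Fin (n + 1) × Fin (n + 1))) : Prop where
  roof_monotone : IsMonotonePolyline U
  floor_monotone : IsMonotonePolyline L
  floor_below_roof : LiesBelow (A.carrier L) (A.carrier U)
  below_roof : LiesBelow (Set.range A.pt) (A.carrier U)
  above_floor : LiesBelow (A.carrier L) (Set.range A.pt)
  roof_subset : polyEdges U ⊆ T
  floor_subset : polyEdges L ⊆ T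
  maximal : Maximal (fun S => S ⊆ A.edgesBetween U L ∧ A.NonCrossing S) T

/-! ### Triangulation polynomials -/

open Classical in
/-- The joint triangulation polynomial `a^{yu}` in the variables `y = X 0` and `u = X 1`.
The roof and the floor are determined by `T` (see `IsPartialTriangulation.roof_floor_unique`),
so this is a sum over all `T` for which some roof and floor exist. -/
noncomputable def jointPoly (A : NearEdge n) : MvPolynomial (Fin 2) ℚ :=
  ∑ p : Finset (Fin (n + 1) × Fin (n + 1)) × Finset (Fin (n + 1)) × Finset (Fin (n + 1)) with
      A.IsPartialTriangulation p.2.1 p.2.2 p.1,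
    MvPolynomial.X 0 ^ (polyEdges p.2.1).card * MvPolynomial.X 1 ^ (polyEdges p.2.2).card

/-- A chain: every edge joining two consecutive points is contained in every triangulation. -/
def IsChain (A : NearEdge n) : Prop :=
  ∀ k : Fin n, ∀ T, A.IsTriangulation T → (k.castSucc, k.succ) ∈ T

open Classical in
/-- The upper triangulation polynomial `t`: the coefficient of `y ^ i` is the number of upper
triangulations with `i` segments, that is, of triangulations of the region between the curve
through all points (the polyline with vertex set `univ`) and a monotone polyline `U` with `i`
segments above it. Used for chains only. -/
noncomputable def upperPoly (A : NearEdge n) : Polynomial ℚ :=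
  ∑ p : Finset (Fin (n + 1) × Fin (n + 1)) × Finset (Fin (n + 1)) with
      A.IsPartialTriangulation p.2 Finset.univ p.1,
    Polynomial.X ^ (polyEdges p.2).card

/-- The near-edge obtained by flipping vertically. -/
def flip (A : NearEdge n) : NearEdge n where
  pt k := ((A.pt k).1, -(A.pt k).2)
  strictMono_fst := A.strictMono_fst
  general_position i j k hij hjk h := by
    apply A.general_position i j k hij hjk
    obtain ⟨p, v, hv⟩ := (collinear_iff_exists_forall_eq_smul_vadd _).1 h
    refine (collinear_iff_exists_forall_eq_smul_vadd _).2 ⟨(p.1, -p.2), (v.1, -v.2), ?_⟩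
    have key : ∀ a : ℝ × ℝ, (∃ r : ℝ, (a.1, -a.2) = r • v +ᵥ p) →
        ∃ r : ℝ, a = r • (v.1, -v.2) +ᵥ (p.1, -p.2) := by
      rintro a ⟨r, hr⟩
      refine ⟨r, ?_⟩
      simp only [Prod.ext_iff, vadd_eq_add, Prod.fst_add, Prod.snd_add, Prod.smul_fst,
        Prod.smul_snd, smul_eq_mul] at hr ⊢
      exact ⟨hr.1, by linarith [hr.2]⟩
    rintro a (rfl | rfl | rfl)
    · exact key _ (hv _ (by simp))
    · exact key _ (hv _ (by simp))
    · exact key _ (hv _ (by simp))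

/-- The lower triangulation polynomial `t*`: the upper one of the flipped near-edge. -/
noncomputable def lowerPoly (A : NearEdge n) : Polynomial ℚ :=
  A.flip.upperPoly

/-! ### The roof and the floor are determined by the set of edges -/

theorem exists_polyEdge {U : Finset (Fin (n + 1))} (hU : IsMonotonePolyline U)
    {k : Fin (n + 1)} (hk : k ∉ U) : ∃ e ∈ polyEdges U, e.1 < k ∧ k < e.2 := by
  have h0 : (U.filter (· < k)).Nonempty :=
    ⟨0, Finset.mem_filter.2 ⟨hU.1, lt_of_le_of_ne (Fin.zero_le k) fun h => hk (h ▸ hU.1)⟩⟩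
  have h1 : (U.filter (k < ·)).Nonempty :=
    ⟨Fin.last n,
      Finset.mem_filter.2 ⟨hU.2, lt_of_le_of_ne (Fin.le_last k) fun h => hk (h ▸ hU.2)⟩⟩
  obtain ⟨a1, a2⟩ := Finset.mem_filter.1 (Finset.max'_mem _ h0)
  obtain ⟨b1, b2⟩ := Finset.mem_filter.1 (Finset.min'_mem _ h1)
  refine ⟨((U.filter (· < k)).max' h0, (U.filter (k < ·)).min' h1), ?_, a2, b2⟩
  refine Finset.mem_filter.2 ⟨Finset.mem_univ _, a1, b1, a2.trans b2, ?_⟩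
  rintro m hm ⟨hm1, hm2⟩
  rcases lt_trichotomy m k with h | h | h
  · exact absurd (Finset.le_max' _ m (Finset.mem_filter.2 ⟨hm, h⟩)) (not_le.2 hm1)
  · exact hk (h ▸ hm)
  · exact absurd (Finset.min'_le _ m (Finset.mem_filter.2 ⟨hm, h⟩)) (not_le.2 hm2)

theorem pt_notMem_seg (A : NearEdge n) {e : Fin (n + 1) × Fin (n + 1)} {k : Fin (n + 1)}
    (h1 : e.1 < k) (h2 : k < e.2) : A.pt k ∉ A.seg e := by
  intro h
  exact A.general_position _ _ _ h1 h2 (mem_segment_iff_wbtw.1 h).collinear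

theorem exists_mem_seg (A : NearEdge n) {e : Fin (n + 1) × Fin (n + 1)} {k : Fin (n + 1)}
    (h1 : e.1 < k) (h2 : k < e.2) : ∃ q ∈ A.seg e, q.1 = (A.pt k).1 := by
  have e1 := A.strictMono_fst h1
  have e2 := A.strictMono_fst h2
  have : (A.pt k).1 ∈ segment ℝ (A.pt e.1).1 (A.pt e.2).1 := by
    rw [segment_eq_Icc (e1.trans e2).le]
    exact ⟨e1.le, e2.le⟩
  obtain ⟨a, b, ha, hb, hab, h⟩ := this
  exact ⟨a • A.pt e.1 + b • A.pt e.2, ⟨a, b, ha, hb, hab, rfl⟩, by simpa using h⟩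

theorem IsPartialTriangulation.roof_subset_roof {A : NearEdge n}
    {U L U' L' : Finset (Fin (n + 1))} {T : Finset (Fin (n + 1) × Fin (n + 1))}
    (h : A.IsPartialTriangulation U L T) (h' : A.IsPartialTriangulation U' L' T) : U ⊆ U' := by
  intro k hk
  by_contra hk'
  obtain ⟨e, he, e1, e2⟩ := exists_polyEdge h'.roof_monotone hk'
  obtain ⟨q, hq, hqk⟩ := A.exists_mem_seg e1 e2
  have a1 : (A.pt k).2 ≤ q.2 := h'.below_roof _ ⟨k, rfl⟩ q
    (Or.inr (Set.mem_biUnion he hq)) hqk.symm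
  have a2 : q.2 ≤ (A.pt k).2 :=
    (mem_edgesBetween.1 (h.maximal.prop.1 (h'.roof_subset he))).2.2 q hq _
      (Or.inl ⟨k, hk, rfl⟩) hqk
  exact A.pt_notMem_seg e1 e2 (Prod.ext hqk (le_antisymm a2 a1) ▸ hq)

theorem IsPartialTriangulation.floor_subset_floor {A : NearEdge n}
    {U L U' L' : Finset (Fin (n + 1))} {T : Finset (Fin (n + 1) × Fin (n + 1))}
    (h : A.IsPartialTriangulation U L T) (h' : A.IsPartialTriangulation U' L' T) : L ⊆ L' := by
  intro k hk
  by_contra hk'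
  obtain ⟨e, he, e1, e2⟩ := exists_polyEdge h'.floor_monotone hk'
  obtain ⟨q, hq, hqk⟩ := A.exists_mem_seg e1 e2
  have a1 : q.2 ≤ (A.pt k).2 := h'.above_floor q (Or.inr (Set.mem_biUnion he hq)) _ ⟨k, rfl⟩ hqk
  have a2 : (A.pt k).2 ≤ q.2 :=
    (mem_edgesBetween.1 (h.maximal.prop.1 (h'.floor_subset he))).2.1 _
      (Or.inl ⟨k, hk, rfl⟩) q hq hqk.symm
  exact A.pt_notMem_seg e1 e2 (Prod.ext hqk (le_antisymm a1 a2) ▸ hq)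

/-- The roof and the floor are determined by the set of edges. -/
theorem IsPartialTriangulation.roof_floor_unique {A : NearEdge n}
    {U L U' L' : Finset (Fin (n + 1))} {T : Finset (Fin (n + 1) × Fin (n + 1))}
    (h : A.IsPartialTriangulation U L T) (h' : A.IsPartialTriangulation U' L' T) :
    U = U' ∧ L = L' :=
  ⟨(h.roof_subset_roof h').antisymm (h'.roof_subset_roof h),
    (h.floor_subset_floor h').antisymm (h'.floor_subset_floor h)⟩

end NearEdge

/-! A roof lies weakly above every point, so it visits every vertex of the upper hull: a roof
segment spanning such a vertex lies in the convex hull, hence would pass through the vertex, against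
general position (`upperHullVertices_subset`). So a roof has at least `i` segments, with equality
only for the upper hull itself (`eq_upperHullVertices`); by reflection the same holds for floors and
`j`. The coefficient at `y^i u^j` therefore counts the partial triangulations between the two hulls.
There every edge is allowed, and hull edges, which nothing can cross, lie in every maximal set, so
these are exactly the triangulations (`isTriangulation_iff`).

For a chain, let `P` be the polyline through all points. Any single edge extends to a triangulation,
which contains all segments of `P`; so no edge crosses `P` (`IsChain.disjoint`). Hence each edge
lies weakly on one side of `P` (`IsChain.liesBelow_or`), and edges on opposite sides do not cross
(`IsChain.disjoint_of_separated`). Maximal non-crossing sets can then be cut along `P` and glued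
again, independently above and below, keeping roof and floor. This bijection factors the polynomial,
and comparing coefficients gives the product formula. -/

namespace NearEdge

variable {n : ℕ} {A : NearEdge n} {e f : Fin (n + 1) × Fin (n + 1)}
  {U L : Finset (Fin (n + 1))} {T : Finset (Fin (n + 1) × Fin (n + 1))}

/-! ### Affine functions of one real variable -/

theorem affine_nonneg_of_mem_Icc {α β l r x : ℝ} (hl : 0 ≤ α + β * l) (hr : 0 ≤ α + β * r)
    (h1 : l ≤ x) (h2 : x ≤ r) : 0 ≤ α + β * x := by
  rcases le_total 0 β with hβ | hβ
  · linarith [mul_le_mul_of_nonneg_left h1 hβ]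
  · linarith [mul_le_mul_of_nonpos_left h2 hβ]

/-- With an inner zero, a nonzero slope would make the function negative at one of the ends. -/
theorem affine_eq_zero_of_touch {α β l r x : ℝ} (hl : 0 ≤ α + β * l) (hr : 0 ≤ α + β * r)
    (h1 : l < x) (h2 : x < r) (hx : α + β * x = 0) : α = 0 ∧ β = 0 := by
  have hβ : β = 0 := by
    rcases lt_trichotomy β 0 with h | h | h
    · nlinarith [mul_lt_mul_of_neg_left h2 h]
    · exact h
    · nlinarith [mul_lt_mul_of_pos_left h1 h]
  subst hβ
  simpa using hx

/-- The product of the end values is `β ^ 2` times the product of the signed distances of `l` and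
`r` from the root `-α / β`; it is nonnegative if the root is not strictly between them. -/
theorem exists_affine_zero {α β l r : ℝ} (hlr : l < r) (h : (α + β * l) * (α + β * r) < 0) :
    ∃ x, l < x ∧ x < r ∧ α + β * x = 0 := by
  have hβ : β ≠ 0 := by
    rintro rfl
    nlinarith [mul_self_nonneg α]
  have hx : α + β * (-α / β) = 0 := by field_simp; ring
  refine ⟨-α / β, ?_, ?_, hx⟩
  · by_contra hc
    have h2 : 0 ≤ β ^ 2 * ((l - -α / β) * (r - -α / β)) :=
      mul_nonneg (sq_nonneg β) (mul_nonneg (by linarith) (by linarith))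
    have : (α + β * l) * (α + β * r) = β ^ 2 * ((l - -α / β) * (r - -α / β)) := by
      field_simp; ring
    linarith
  · by_contra hc
    have h2 : 0 ≤ β ^ 2 * ((-α / β - l) * (-α / β - r)) :=
      mul_nonneg (sq_nonneg β) (mul_nonneg (by linarith) (by linarith))
    have : (α + β * l) * (α + β * r) = β ^ 2 * ((-α / β - l) * (-α / β - r)) := by
      field_simp; ring
    linarith

/-! ### Edges as graphs of affine functions -/

theorem mem_allEdges : e ∈ allEdges n ↔ e.1 < e.2 := by simp [allEdges]

theorem fst_lt_fst_iff {a b : Fin (n + 1)} : (A.pt a).1 < (A.pt b).1 ↔ a < b :=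
  A.strictMono_fst.lt_iff_lt

theorem fst_le_fst_iff {a b : Fin (n + 1)} : (A.pt a).1 ≤ (A.pt b).1 ↔ a ≤ b :=
  A.strictMono_fst.le_iff_le

theorem fst_inj {a b : Fin (n + 1)} : (A.pt a).1 = (A.pt b).1 ↔ a = b :=
  A.strictMono_fst.injective.eq_iff

/-- The height over `x` of the line through the endpoints of `e`. -/
noncomputable def line (A : NearEdge n) (e : Fin (n + 1) × Fin (n + 1)) (x : ℝ) : ℝ :=
  (A.pt e.1).2 + ((A.pt e.2).2 - (A.pt e.1).2) / ((A.pt e.2).1 - (A.pt e.1).1) *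
    (x - (A.pt e.1).1)

theorem line_fst : A.line e (A.pt e.1).1 = (A.pt e.1).2 := by simp [line]

theorem line_snd (h : e.1 < e.2) : A.line e (A.pt e.2).1 = (A.pt e.2).2 := by
  have : (A.pt e.2).1 - (A.pt e.1).1 ≠ 0 := (sub_pos.2 (A.strictMono_fst h)).ne'
  rw [line, div_mul_cancel₀ _ this]
  ring

theorem exists_line_sub_line (A : NearEdge n) (e f : Fin (n + 1) × Fin (n + 1)) :
    ∃ α β : ℝ, ∀ x, A.line e x - A.line f x = α + β * x := by
  obtain ⟨s, hs⟩ : ∃ s, s = ((A.pt e.2).2 - (A.pt e.1).2) / ((A.pt e.2).1 - (A.pt e.1).1) :=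
    ⟨_, rfl⟩
  obtain ⟨t, ht⟩ : ∃ t, t = ((A.pt f.2).2 - (A.pt f.1).2) / ((A.pt f.2).1 - (A.pt f.1).1) :=
    ⟨_, rfl⟩
  refine ⟨(A.pt e.1).2 - s * (A.pt e.1).1 - (A.pt f.1).2 + t * (A.pt f.1).1, s - t, fun x => ?_⟩
  simp only [line, ← hs, ← ht]
  ring

theorem line_combo (h : e.1 < e.2) {a b : ℝ} (hab : a + b = 1) :
    A.line e (a * (A.pt e.1).1 + b * (A.pt e.2).1) = a * (A.pt e.1).2 + b * (A.pt e.2).2 := by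
  have : (A.pt e.2).1 - (A.pt e.1).1 ≠ 0 := (sub_pos.2 (A.strictMono_fst h)).ne'
  obtain rfl : a = 1 - b := by linarith
  rw [line]
  field_simp
  ring

theorem mem_seg_iff (h : e.1 < e.2) {p : ℝ × ℝ} :
    p ∈ A.seg e ↔ (A.pt e.1).1 ≤ p.1 ∧ p.1 ≤ (A.pt e.2).1 ∧ p.2 = A.line e p.1 := by
  have hlt := A.strictMono_fst h
  simp only at hlt
  constructor
  · rintro ⟨a, b, ha, hb, hab, rfl⟩
    have := line_combo (A := A) h hab
    obtain rfl : a = 1 - b := by linarith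
    simp only [Prod.fst_add, Prod.smul_fst, Prod.snd_add, Prod.smul_snd, smul_eq_mul, this]
    refine ⟨?_, ?_, trivial⟩
    · nlinarith
    · nlinarith
  · rintro ⟨h1, h2, h3⟩
    have hx : p.1 ∈ segment ℝ (A.pt e.1).1 (A.pt e.2).1 := by
      rw [segment_eq_Icc hlt.le]
      exact ⟨h1, h2⟩
    obtain ⟨a, b, ha, hb, hab, hx⟩ := hx
    simp only [smul_eq_mul] at hx
    refine ⟨a, b, ha, hb, hab, Prod.ext (by simpa using hx) ?_⟩
    rw [h3, ← hx, line_combo h hab]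
    simp

theorem mem_openSegment_iff (h : e.1 < e.2) {p : ℝ × ℝ} :
    p ∈ openSegment ℝ (A.pt e.1) (A.pt e.2) ↔
      (A.pt e.1).1 < p.1 ∧ p.1 < (A.pt e.2).1 ∧ p.2 = A.line e p.1 := by
  have hlt := A.strictMono_fst h
  simp only at hlt
  constructor
  · rintro ⟨a, b, ha, hb, hab, rfl⟩
    have := line_combo (A := A) h hab
    obtain rfl : a = 1 - b := by linarith
    simp only [Prod.fst_add, Prod.smul_fst, Prod.snd_add, Prod.smul_snd, smul_eq_mul, this]
    refine ⟨?_, ?_, trivial⟩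
    · nlinarith
    · nlinarith
  · rintro ⟨h1, h2, h3⟩
    have hx : p.1 ∈ openSegment ℝ (A.pt e.1).1 (A.pt e.2).1 := by
      rw [openSegment_eq_Ioo hlt]
      exact ⟨h1, h2⟩
    obtain ⟨a, b, ha, hb, hab, hx⟩ := hx
    simp only [smul_eq_mul] at hx
    refine ⟨a, b, ha, hb, hab, Prod.ext (by simpa using hx) ?_⟩
    rw [h3, ← hx, line_combo h hab]
    simp

theorem pt_snd_ne_line {k : Fin (n + 1)} (h1 : e.1 < k) (h2 : k < e.2) :
    (A.pt k).2 ≠ A.line e (A.pt k).1 := fun h =>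
  A.pt_notMem_seg h1 h2 ((mem_seg_iff (h1.trans h2)).2
    ⟨(A.strictMono_fst h1).le, (A.strictMono_fst h2).le, h⟩)

theorem line_le_line {l r x : ℝ} (hl : A.line f l ≤ A.line e l) (hr : A.line f r ≤ A.line e r)
    (h1 : l ≤ x) (h2 : x ≤ r) : A.line f x ≤ A.line e x := by
  obtain ⟨α, β, h⟩ := A.exists_line_sub_line e f
  have := affine_nonneg_of_mem_Icc (α := α) (β := β) (by rw [← h]; linarith)
    (by rw [← h]; linarith) h1 h2
  rw [← h] at this
  linarith

/-- Overlapping edges on a common line are equal. -/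
theorem eq_of_line_eq (he : e.1 < e.2) (hf : f.1 < f.2) (h1 : e.1 < f.2) (h2 : f.1 < e.2)
    (h : ∀ x, A.line e x = A.line f x) : e = f := by
  -- If two corresponding endpoints differed, one of them would lie strictly inside the other edge's
  -- range and on its line, against general position.
  have a1 : ¬ e.1 < f.1 := fun hlt => pt_snd_ne_line (A := A) hlt h2 (by rw [h, line_fst])
  have a2 : ¬ f.1 < e.1 := fun hlt => pt_snd_ne_line (A := A) hlt h1 (by rw [← h, line_fst])
  have a3 : ¬ e.2 < f.2 := fun hlt => pt_snd_ne_line (A := A) h2 hlt (by rw [← h, line_snd he])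
  have a4 : ¬ f.2 < e.2 := fun hlt => pt_snd_ne_line (A := A) h1 hlt (by rw [h, line_snd hf])
  exact Prod.ext (le_antisymm (not_lt.1 a2) (not_lt.1 a1))
    (le_antisymm (not_lt.1 a4) (not_lt.1 a3))

/-- An edge that touches an edge above it from below in a common inner point equals it. -/
theorem eq_of_touch (he : e.1 < e.2) (hf : f.1 < f.2) (h : LiesBelow (A.seg f) (A.seg e))
    {p : ℝ × ℝ} (hpe : p ∈ openSegment ℝ (A.pt e.1) (A.pt e.2))
    (hpf : p ∈ openSegment ℝ (A.pt f.1) (A.pt f.2)) : e = f := by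
  rw [mem_openSegment_iff he] at hpe
  rw [mem_openSegment_iff hf] at hpf
  obtain ⟨e1, e2, e3⟩ := hpe
  obtain ⟨f1, f2, f3⟩ := hpf
  obtain ⟨α, β, hd⟩ := A.exists_line_sub_line e f
  have key : ∀ x, (A.pt e.1).1 ≤ x → x ≤ (A.pt e.2).1 → (A.pt f.1).1 ≤ x → x ≤ (A.pt f.2).1 →
      0 ≤ α + β * x := by
    intro x x1 x2 x3 x4
    have := h (x, A.line f x) ((mem_seg_iff hf).2 ⟨x3, x4, rfl⟩)
      (x, A.line e x) ((mem_seg_iff he).2 ⟨x1, x2, rfl⟩) rfl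
    rw [← hd]
    exact sub_nonneg.2 this
  -- The difference of the two lines is nonnegative at both ends of the common range and zero at the
  -- inner point `p`, so it vanishes identically.
  have hl := max_lt e1 f1
  have hr := lt_min e2 f2
  obtain ⟨rfl, rfl⟩ := affine_eq_zero_of_touch
    (key _ (le_max_left _ _) (hl.trans e2).le (le_max_right _ _) (hl.trans f2).le)
    (key _ (e1.trans hr).le (min_le_left _ _) (f1.trans hr).le (min_le_right _ _))
    hl hr (by rw [← hd]; linarith)
  exact eq_of_line_eq he hf (fst_lt_fst_iff.1 (e1.trans f2)) (fst_lt_fst_iff.1 (f1.trans e2))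
    fun x => by linarith [hd x]

/-! ### Polylines -/

theorem mem_polyEdges : e ∈ polyEdges U ↔
    e.1 ∈ U ∧ e.2 ∈ U ∧ e.1 < e.2 ∧ ∀ m ∈ U, ¬ (e.1 < m ∧ m < e.2) := by simp [polyEdges]

theorem lt_of_mem_polyEdges (h : e ∈ polyEdges U) : e.1 < e.2 := (mem_polyEdges.1 h).2.2.1

theorem seg_subset_carrier (h : e ∈ polyEdges U) : A.seg e ⊆ A.carrier U := fun _ hp =>
  Or.inr (Set.mem_biUnion h hp)

/-- The vertex case is needed on its own account: for `n = 0` a polyline has no segments. -/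
theorem mem_carrier {p : ℝ × ℝ} : p ∈ A.carrier U ↔
    (∃ k ∈ U, A.pt k = p) ∨ ∃ e ∈ polyEdges U, p ∈ openSegment ℝ (A.pt e.1) (A.pt e.2) := by
  constructor
  · rintro (⟨k, hk, rfl⟩ | h)
    · exact Or.inl ⟨k, hk, rfl⟩
    · obtain ⟨e, he, hp⟩ := Set.mem_iUnion₂.1 h
      obtain ⟨h1, h2, h3, -⟩ := mem_polyEdges.1 he
      rw [mem_seg_iff h3] at hp
      rcases hp.1.eq_or_lt with h | h4
      · exact Or.inl ⟨_, h1, Prod.ext h (by rw [hp.2.2, ← h, line_fst])⟩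
      rcases hp.2.1.eq_or_lt with h | h5
      · exact Or.inl ⟨_, h2, Prod.ext h.symm (by rw [hp.2.2, h, line_snd h3])⟩
      exact Or.inr ⟨e, he, (mem_openSegment_iff h3).2 ⟨h4, h5, hp.2.2⟩⟩
  · rintro (⟨k, hk, rfl⟩ | ⟨e, he, hp⟩)
    · exact Or.inl ⟨k, hk, rfl⟩
    · exact seg_subset_carrier he (openSegment_subset_segment _ _ _ hp)

/-- A monotone polyline is the graph of a function: no vertex lies strictly inside the range of a
segment, so segments with overlapping ranges share both endpoints. -/
theorem eq_of_mem_carrier {p q : ℝ × ℝ} (hp : p ∈ A.carrier U) (hq : q ∈ A.carrier U)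
    (h : p.1 = q.1) : p = q := by
  have aux : ∀ k ∈ U, ∀ e ∈ polyEdges U, ∀ r ∈ openSegment ℝ (A.pt e.1) (A.pt e.2),
      (A.pt k).1 ≠ r.1 := by
    intro k hk e he r hr hkr
    obtain ⟨-, -, h3, h4⟩ := mem_polyEdges.1 he
    rw [mem_openSegment_iff h3, ← hkr, fst_lt_fst_iff, fst_lt_fst_iff] at hr
    exact h4 k hk ⟨hr.1, hr.2.1⟩
  rcases mem_carrier.1 hp with ⟨k, hk, rfl⟩ | ⟨e, he, hpe⟩ <;>
    rcases mem_carrier.1 hq with ⟨m, hm, rfl⟩ | ⟨f, hf, hqf⟩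
  · rw [fst_inj.1 h]
  · exact absurd h (aux k hk f hf q hqf)
  · exact absurd h.symm (aux m hm e he p hpe)
  · obtain ⟨e1, e2, e3, e4⟩ := mem_polyEdges.1 he
    obtain ⟨f1, f2, f3, f4⟩ := mem_polyEdges.1 hf
    rw [mem_openSegment_iff e3] at hpe
    rw [mem_openSegment_iff f3, ← h] at hqf
    have l1 : e.1 < f.2 := fst_lt_fst_iff.1 (hpe.1.trans hqf.2.1)
    have l2 : f.1 < e.2 := fst_lt_fst_iff.1 (hqf.1.trans hpe.2.1)
    have a1 := e4 f.1 f1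
    have a2 := e4 f.2 f2
    have a3 := f4 e.1 e1
    have a4 := f4 e.2 e2
    obtain rfl : e = f := Prod.ext (by grind) (by grind)
    exact Prod.ext h (hpe.2.2.trans hqf.2.2.symm)

theorem carrier_liesBelow_self : LiesBelow (A.carrier U) (A.carrier U) := fun _ hp _ hq h => by
  rw [eq_of_mem_carrier hp hq h]

/-- The last vertex weakly left of `x` and the first one weakly right of it are consecutive, unless
the former lies exactly over `x`. -/
theorem exists_mem_carrier (hU : IsMonotonePolyline U) {x : ℝ} (h0 : (A.pt 0).1 ≤ x)
    (h1 : x ≤ (A.pt (Fin.last n)).1) : ∃ q ∈ A.carrier U, q.1 = x := by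
  classical
  have hS : (U.filter fun k => (A.pt k).1 ≤ x).Nonempty := ⟨0, Finset.mem_filter.2 ⟨hU.1, h0⟩⟩
  have hT : (U.filter fun k => x ≤ (A.pt k).1).Nonempty :=
    ⟨Fin.last n, Finset.mem_filter.2 ⟨hU.2, h1⟩⟩
  obtain ⟨a1, a2⟩ := Finset.mem_filter.1 (Finset.max'_mem _ hS)
  obtain ⟨b1, b2⟩ := Finset.mem_filter.1 (Finset.min'_mem _ hT)
  have a3 : ∀ k ∈ U, (A.pt k).1 ≤ x → k ≤ (U.filter fun k => (A.pt k).1 ≤ x).max' hS := fun k hk hkx =>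
    Finset.le_max' _ k (Finset.mem_filter.2 ⟨hk, hkx⟩)
  have b3 : ∀ k ∈ U, x ≤ (A.pt k).1 → (U.filter fun k => x ≤ (A.pt k).1).min' hT ≤ k := fun k hk hkx =>
    Finset.min'_le _ k (Finset.mem_filter.2 ⟨hk, hkx⟩)
  generalize (U.filter fun k => (A.pt k).1 ≤ x).max' hS = a at *
  generalize (U.filter fun k => x ≤ (A.pt k).1).min' hT = b at *
  rcases a2.eq_or_lt with h | h
  · exact ⟨A.pt a, Or.inl ⟨a, a1, rfl⟩, h⟩
  have hab : a < b := fst_lt_fst_iff.1 (h.trans_le b2)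
  refine ⟨(x, A.line (a, b) x), seg_subset_carrier (e := (a, b)) ?_
    ((mem_seg_iff hab).2 ⟨a2, b2, rfl⟩), rfl⟩
  refine mem_polyEdges.2 ⟨a1, b1, hab, ?_⟩
  rintro m hm ⟨m1, m2⟩
  rcases le_total (A.pt m).1 x with hx | hx
  · exact absurd (a3 m hm hx) (not_le.2 m1)
  · exact absurd (b3 m hm hx) (not_le.2 m2)

theorem range_seg (h : e.1 < e.2) {p : ℝ × ℝ} (hp : p ∈ A.seg e) :
    (A.pt 0).1 ≤ p.1 ∧ p.1 ≤ (A.pt (Fin.last n)).1 := by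
  rw [mem_seg_iff h] at hp
  exact ⟨(fst_le_fst_iff.2 (Fin.zero_le _)).trans hp.1,
    hp.2.1.trans (fst_le_fst_iff.2 (Fin.le_last _))⟩

theorem range_carrier {p : ℝ × ℝ} (hp : p ∈ A.carrier U) :
    (A.pt 0).1 ≤ p.1 ∧ p.1 ≤ (A.pt (Fin.last n)).1 := by
  rcases mem_carrier.1 hp with ⟨k, hk, rfl⟩ | ⟨e, he, hpe⟩
  · exact ⟨fst_le_fst_iff.2 (Fin.zero_le _), fst_le_fst_iff.2 (Fin.le_last _)⟩
  · exact range_seg (lt_of_mem_polyEdges he) (openSegment_subset_segment _ _ _ hpe)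

/-- `LiesBelow` is not transitive in general, since the middle set may miss a vertical line; a
monotone polyline meets all those in the range of the points. -/
theorem LiesBelow.trans_carrier {X Y : Set (ℝ × ℝ)} (hU : IsMonotonePolyline U)
    (h1 : LiesBelow X (A.carrier U)) (h2 : LiesBelow (A.carrier U) Y)
    (hX : ∀ p ∈ X, (A.pt 0).1 ≤ p.1 ∧ p.1 ≤ (A.pt (Fin.last n)).1) : LiesBelow X Y := by
  intro p hp q hq hpq
  obtain ⟨r, hr, hrp⟩ := exists_mem_carrier (A := A) hU (hX p hp).1 (hX p hp).2
  exact (h1 p hp r hr hrp.symm).trans (h2 r hr q hq (hrp.trans hpq))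

theorem isMonotonePolyline_univ : IsMonotonePolyline (n := n) Finset.univ := by
  simp [IsMonotonePolyline]

theorem mem_polyEdges_univ : e ∈ polyEdges Finset.univ ↔
    ∃ k : Fin n, e = (k.castSucc, k.succ) := by
  rw [mem_polyEdges]
  constructor
  · rintro ⟨-, -, h, h'⟩
    have hn : e.1.val < n := by have := Fin.lt_def.1 h; omega
    refine ⟨⟨e.1.val, hn⟩, Prod.ext (Fin.ext rfl) (Fin.ext ?_)⟩
    have := h' ⟨e.1.val + 1, by omega⟩ (Finset.mem_univ _)
    simp only [Fin.lt_def] at this h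
    simp only [Fin.val_succ]
    omega
  · rintro ⟨k, rfl⟩
    refine ⟨Finset.mem_univ _, Finset.mem_univ _, Fin.castSucc_lt_succ, ?_⟩
    intro m _
    simp only [Fin.lt_def, Fin.val_castSucc, Fin.val_succ]
    omega

/-- Between consecutive points both sides are affine, so the comparison at the points suffices. -/
theorem carrier_univ_liesBelow_seg (hf : f.1 < f.2)
    (h : ∀ k, f.1 ≤ k → k ≤ f.2 → (A.pt k).2 ≤ A.line f (A.pt k).1) :
    LiesBelow (A.carrier Finset.univ) (A.seg f) := by
  intro p hp q hq hpq
  rw [mem_seg_iff hf, ← hpq] at hq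
  obtain ⟨q1, q2, q3⟩ := hq
  rw [q3]
  rcases mem_carrier.1 hp with ⟨k, -, rfl⟩ | ⟨c, hc, hpc⟩
  · exact h k (fst_le_fst_iff.1 q1) (fst_le_fst_iff.1 q2)
  · obtain ⟨-, -, c1, c2⟩ := mem_polyEdges.1 hc
    rw [mem_openSegment_iff c1] at hpc
    obtain ⟨p1, p2, p3⟩ := hpc
    have l1 : f.1 < c.2 := fst_lt_fst_iff.1 (q1.trans_lt p2)
    have l2 : c.1 < f.2 := fst_lt_fst_iff.1 (p1.trans_le q2)
    have l3 : f.1 ≤ c.1 := not_lt.1 fun hlt => c2 _ (Finset.mem_univ _) ⟨hlt, l1⟩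
    have l4 : c.2 ≤ f.2 := not_lt.1 fun hlt => c2 _ (Finset.mem_univ _) ⟨l2, hlt⟩
    rw [p3]
    refine line_le_line ?_ ?_ p1.le p2.le
    · rw [line_fst]
      exact h _ l3 l2.le
    · rw [line_snd c1]
      exact h _ l1.le l4

theorem carrier_univ_liesBelow_carrier (h : LiesBelow (Set.range A.pt) (A.carrier U)) :
    LiesBelow (A.carrier Finset.univ) (A.carrier U) := by
  intro p hp q hq hpq
  rcases mem_carrier.1 hq with ⟨k, hk, rfl⟩ | ⟨f, hf, hqf⟩
  · rw [eq_of_mem_carrier hp (Or.inl ⟨k, by simp, rfl⟩) hpq]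
  · have hlt := lt_of_mem_polyEdges hf
    refine carrier_univ_liesBelow_seg hlt (fun k h1 h2 => ?_) p hp q
      (openSegment_subset_segment _ _ _ hqf) hpq
    exact h _ ⟨k, rfl⟩ (_, A.line f (A.pt k).1) (seg_subset_carrier hf ((mem_seg_iff hlt).2
      ⟨fst_le_fst_iff.2 h1, fst_le_fst_iff.2 h2, rfl⟩)) rfl

/-- Each vertex except the last is the left end of exactly one segment. -/
theorem card_polyEdges (hU : IsMonotonePolyline U) : (polyEdges U).card + 1 = U.card := by
  rw [← Finset.card_erase_add_one hU.2, Nat.add_right_cancel_iff]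
  refine Finset.card_nbij Prod.fst ?_ ?_ ?_
  · intro e he
    obtain ⟨h1, -, h3, -⟩ := mem_polyEdges.1 he
    exact Finset.mem_erase.2 ⟨(h3.trans_le (Fin.le_last _)).ne, h1⟩
  · intro e he f hf hef
    obtain ⟨-, e2, e3, e4⟩ := mem_polyEdges.1 he
    obtain ⟨-, f2, f3, f4⟩ := mem_polyEdges.1 hf
    have a1 := e4 f.2 f2
    have a2 := f4 e.2 e2
    exact Prod.ext hef (by grind)
  · intro a ha
    obtain ⟨ha1, ha2⟩ := Finset.mem_erase.1 ha
    have h1 : (U.filter (a < ·)).Nonempty :=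
      ⟨Fin.last n, Finset.mem_filter.2 ⟨hU.2, lt_of_le_of_ne (Fin.le_last a) ha1⟩⟩
    obtain ⟨b1, b2⟩ := Finset.mem_filter.1 (Finset.min'_mem _ h1)
    refine ⟨(a, (U.filter (a < ·)).min' h1), mem_polyEdges.2 ⟨ha2, b1, b2, ?_⟩, rfl⟩
    rintro m hm ⟨m1, m2⟩
    exact absurd (Finset.min'_le _ m (Finset.mem_filter.2 ⟨hm, m1⟩)) (not_le.2 m2)

/-! ### Vertical reflection -/

/-- The reflection of the plane in the `x`-axis. -/
def reflect : ℝ × ℝ →ₗ[ℝ] ℝ × ℝ where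
  toFun p := (p.1, -p.2)
  map_add' p q := Prod.ext rfl (by simp; ring)
  map_smul' c p := Prod.ext rfl (by simp)

theorem reflect_apply (p : ℝ × ℝ) : reflect p = (p.1, -p.2) := rfl

theorem reflect_reflect (p : ℝ × ℝ) : reflect (reflect p) = p := by simp [reflect_apply]

theorem reflect_injective : Function.Injective reflect := fun p q h => by
  rw [← reflect_reflect p, h, reflect_reflect]

theorem liesBelow_reflect {X Y : Set (ℝ × ℝ)} :
    LiesBelow (reflect '' X) (reflect '' Y) ↔ LiesBelow Y X := by
  constructor
  · intro h p hp q hq hpq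
    simpa [reflect_apply] using h _ ⟨q, hq, rfl⟩ _ ⟨p, hp, rfl⟩ hpq.symm
  · rintro h _ ⟨q, hq, rfl⟩ _ ⟨p, hp, rfl⟩ hpq
    simpa [reflect_apply] using h p hp q hq hpq.symm

theorem flip_pt (A : NearEdge n) (k : Fin (n + 1)) : A.flip.pt k = reflect (A.pt k) := rfl

theorem flip_flip (A : NearEdge n) : A.flip.flip = A := by
  cases A
  simp [flip]

theorem range_flip_pt (A : NearEdge n) : Set.range A.flip.pt = reflect '' Set.range A.pt := by
  rw [← Set.range_comp]
  rfl

theorem convexHull_flip (A : NearEdge n) :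
    convexHull ℝ (Set.range A.flip.pt) = reflect '' convexHull ℝ (Set.range A.pt) := by
  rw [range_flip_pt, LinearMap.image_convexHull]

theorem openSegment_flip (A : NearEdge n) (a b : Fin (n + 1)) :
    openSegment ℝ (A.flip.pt a) (A.flip.pt b) = reflect '' openSegment ℝ (A.pt a) (A.pt b) :=
  (image_openSegment ℝ reflect.toAffineMap _ _).symm

theorem seg_flip (A : NearEdge n) (e : Fin (n + 1) × Fin (n + 1)) :
    A.flip.seg e = reflect '' A.seg e :=
  (image_segment ℝ reflect.toAffineMap _ _).symm

theorem carrier_flip (A : NearEdge n) (U : Finset (Fin (n + 1))) :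
    A.flip.carrier U = reflect '' A.carrier U := by
  simp only [carrier, Set.image_union, Set.image_iUnion, ← seg_flip, Set.image_image]
  rfl

theorem edgesBetween_flip (A : NearEdge n) (U L : Finset (Fin (n + 1))) :
    A.flip.edgesBetween U L = A.edgesBetween L U := by
  ext e
  simp only [mem_edgesBetween, carrier_flip, seg_flip, liesBelow_reflect]
  tauto

theorem nonCrossing_flip : A.flip.NonCrossing T ↔ A.NonCrossing T := by
  simp only [NonCrossing, openSegment_flip, Set.disjoint_image_iff reflect_injective]

theorem IsTriangulation.of_flip (h : A.flip.IsTriangulation T) : A.IsTriangulation T := by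
  simpa only [IsTriangulation, nonCrossing_flip] using h

theorem IsChain.flip (h : A.IsChain) : A.flip.IsChain := fun k T hT => h k T hT.of_flip

theorem IsPartialTriangulation.flip (h : A.IsPartialTriangulation U L T) :
    A.flip.IsPartialTriangulation L U T where
  roof_monotone := h.floor_monotone
  floor_monotone := h.roof_monotone
  floor_below_roof := by
    simpa only [carrier_flip, liesBelow_reflect] using h.floor_below_roof
  below_roof := by
    simpa only [carrier_flip, range_flip_pt, liesBelow_reflect] using h.above_floor
  above_floor := by
    simpa only [carrier_flip, range_flip_pt, liesBelow_reflect] using h.below_roof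
  roof_subset := h.floor_subset
  floor_subset := h.roof_subset
  maximal := by simpa only [edgesBetween_flip, nonCrossing_flip] using h.maximal

theorem isPartialTriangulation_flip :
    A.flip.IsPartialTriangulation L U T ↔ A.IsPartialTriangulation U L T :=
  ⟨fun h => by simpa only [flip_flip] using h.flip, fun h => h.flip⟩

theorem upperHullEdges_flip (A : NearEdge n) : A.flip.upperHullEdges = A.lowerHullEdges := by
  classical
  ext e
  simp only [upperHullEdges, lowerHullEdges, convexHull_flip, seg_flip, Finset.mem_filter,
    liesBelow_reflect]

/-! ### Non-crossing sets -/

theorem NonCrossing.insert (hT : A.NonCrossing T)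
    (h : ∀ f ∈ T, e ≠ f →
      Disjoint (openSegment ℝ (A.pt e.1) (A.pt e.2)) (openSegment ℝ (A.pt f.1) (A.pt f.2))) :
    A.NonCrossing (insert e T) := by
  intro a ha b hb hab
  rcases Finset.mem_insert.1 ha with ha' | ha' <;> rcases Finset.mem_insert.1 hb with hb' | hb'
  · exact absurd (ha'.trans hb'.symm) hab
  · subst ha'
    exact h b hb' hab
  · subst hb'
    exact (h a ha' hab.symm).symm
  · exact hT a ha' b hb' hab

/-- Adjoining an allowed edge that crosses nothing keeps the set admissible, so maximality forces
the edge to be present already. -/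
theorem mem_of_maximal {E : Finset (Fin (n + 1) × Fin (n + 1))}
    (hT : Maximal (fun S => S ⊆ E ∧ A.NonCrossing S) T) (he : e ∈ E)
    (h : ∀ f ∈ T, e ≠ f →
      Disjoint (openSegment ℝ (A.pt e.1) (A.pt e.2)) (openSegment ℝ (A.pt f.1) (A.pt f.2))) :
    e ∈ T :=
  hT.le_of_ge (y := insert e T) ⟨Finset.insert_subset he hT.prop.1, hT.prop.2.insert h⟩
    (Finset.subset_insert _ _) (Finset.mem_insert_self _ _)

/-! ### The convex hull -/

theorem mem_upperHullEdges : e ∈ A.upperHullEdges ↔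
    e.1 < e.2 ∧ LiesBelow (convexHull ℝ (Set.range A.pt)) (A.seg e) := by
  simp [upperHullEdges, mem_allEdges]

theorem seg_subset_convexHull (A : NearEdge n) (e : Fin (n + 1) × Fin (n + 1)) :
    A.seg e ⊆ convexHull ℝ (Set.range A.pt) :=
  segment_subset_convexHull ⟨_, rfl⟩ ⟨_, rfl⟩

theorem carrier_subset_convexHull (A : NearEdge n) (U : Finset (Fin (n + 1))) :
    A.carrier U ⊆ convexHull ℝ (Set.range A.pt) := by
  rintro p (⟨k, -, rfl⟩ | h)
  · exact subset_convexHull ℝ _ ⟨k, rfl⟩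
  · obtain ⟨e, -, hp⟩ := Set.mem_iUnion₂.1 h
    exact A.seg_subset_convexHull e hp

theorem exists_line (A : NearEdge n) (e : Fin (n + 1) × Fin (n + 1)) :
    ∃ α β : ℝ, ∀ x, A.line e x = α + β * x :=
  ⟨(A.pt e.1).2 - ((A.pt e.2).2 - (A.pt e.1).2) / ((A.pt e.2).1 - (A.pt e.1).1) * (A.pt e.1).1,
    ((A.pt e.2).2 - (A.pt e.1).2) / ((A.pt e.2).1 - (A.pt e.1).1), fun x => by rw [line]; ring⟩

/-- The half-plane below a line is convex, so it contains the hull once it contains the points. -/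
theorem mem_upperHullEdges_of_forall_le (he : e.1 < e.2)
    (h : ∀ k, (A.pt k).2 ≤ A.line e (A.pt k).1) : e ∈ A.upperHullEdges := by
  obtain ⟨α, β, hl⟩ := A.exists_line e
  refine mem_upperHullEdges.2 ⟨he, fun p hp q hq hpq => ?_⟩
  rw [mem_seg_iff he] at hq
  have hconv : Convex ℝ {p : ℝ × ℝ | p.2 ≤ α + β * p.1} := by
    intro p hp q hq a b ha hb hab
    simp only [Set.mem_ofPred_eq, Prod.fst_add, Prod.smul_fst, Prod.snd_add, Prod.smul_snd,
      smul_eq_mul] at hp hq ⊢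
    have := add_le_add (mul_le_mul_of_nonneg_left hp ha) (mul_le_mul_of_nonneg_left hq hb)
    obtain rfl : a = 1 - b := by linarith
    linarith
  have : p ∈ {p : ℝ × ℝ | p.2 ≤ α + β * p.1} := by
    refine convexHull_min ?_ hconv hp
    rintro _ ⟨k, rfl⟩
    simpa only [Set.mem_ofPred_eq, ← hl] using h k
  rw [hq.2.2, ← hpq, hl]
  exact this

/-- Fix `x` inside the gap and take the spanning edge that is highest over `x`. A point above its
line could replace the endpoint on the same side of the gap and give a higher edge. -/
theorem exists_upperHullEdge (A : NearEdge n) (k : Fin n) :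
    ∃ e ∈ A.upperHullEdges, e.1 ≤ k.castSucc ∧ k.succ ≤ e.2 := by
  have hk : (A.pt k.castSucc).1 < (A.pt k.succ).1 := A.strictMono_fst Fin.castSucc_lt_succ
  obtain ⟨x, hx1, hx2⟩ := exists_between hk
  obtain ⟨e, he, hmax⟩ := Finset.exists_max_image
    (Finset.univ.filter fun e : Fin (n + 1) × Fin (n + 1) => e.1 ≤ k.castSucc ∧ k.succ ≤ e.2)
    (fun e => A.line e x) ⟨(k.castSucc, k.succ), by simp⟩
  simp only [Finset.mem_filter, Finset.mem_univ, true_and] at he hmax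
  have hlt : ∀ g : Fin (n + 1) × Fin (n + 1), g.1 ≤ k.castSucc → k.succ ≤ g.2 → g.1 < g.2 :=
    fun g h1 h2 => (h1.trans_lt Fin.castSucc_lt_succ).trans_le h2
  have he' := hlt e he.1 he.2
  refine ⟨e, mem_upperHullEdges_of_forall_le he' fun m => ?_, he⟩
  by_contra! hm
  have hx3 : (A.pt e.1).1 < x := (fst_le_fst_iff.2 he.1).trans_lt hx1
  have hx4 : x < (A.pt e.2).1 := hx2.trans_le (fst_le_fst_iff.2 he.2)
  rcases le_or_gt m k.castSucc with h | h
  · have hg := hlt (m, e.2) h he.2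
    -- The difference of the lines is zero at the shared right end and positive at `m`, hence
    -- positive at `x`.
    obtain ⟨α, β, hd⟩ := A.exists_line_sub_line (m, e.2) e
    have d1 := hd (A.pt m).1
    have d2 := hd (A.pt e.2).1
    have d3 := hd x
    rw [line_snd he', line_snd hg, sub_self] at d2
    have d4 := hmax (m, e.2) ⟨h, he.2⟩
    have d5 : A.line (m, e.2) (A.pt m).1 = (A.pt m).2 := line_fst
    have hx5 : (A.pt m).1 < x := (fst_le_fst_iff.2 h).trans_lt hx1
    have p1 : 0 < -β * ((A.pt e.2).1 - (A.pt m).1) := by linarith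
    have p2 : 0 < -β := pos_of_mul_pos_left p1 (by linarith)
    have p3 := mul_pos p2 (sub_pos.2 hx4)
    linarith
  · have h : k.succ ≤ m := Fin.castSucc_lt_iff_succ_le.1 h
    have hg := hlt (e.1, m) he.1 h
    obtain ⟨α, β, hd⟩ := A.exists_line_sub_line (e.1, m) e
    have d1 := hd (A.pt m).1
    have d2 := hd (A.pt e.1).1
    have d3 := hd x
    have d6 : A.line (e.1, m) (A.pt e.1).1 = (A.pt e.1).2 := line_fst
    rw [line_fst (e := e), d6, sub_self] at d2
    have d4 := hmax (e.1, m) ⟨he.1, h⟩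
    have d5 : A.line (e.1, m) (A.pt m).1 = (A.pt m).2 := line_snd hg
    have hx5 : x < (A.pt m).1 := hx2.trans_le (fst_le_fst_iff.2 h)
    have p1 : 0 < β * ((A.pt m).1 - (A.pt e.1).1) := by linarith
    have p2 : 0 < β := pos_of_mul_pos_left p1 (by linarith)
    have p3 := mul_pos p2 (sub_pos.2 hx3)
    linarith

theorem disjoint_of_mem_upperHullEdges (he : e ∈ A.upperHullEdges) (hf : f.1 < f.2)
    (hne : e ≠ f) :
    Disjoint (openSegment ℝ (A.pt e.1) (A.pt e.2)) (openSegment ℝ (A.pt f.1) (A.pt f.2)) := by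
  obtain ⟨he, h⟩ := mem_upperHullEdges.1 he
  exact Set.disjoint_left.2 fun p hpe hpf => hne (eq_of_touch he hf
    (fun q hq => h q (A.seg_subset_convexHull f hq)) hpe hpf)

/-- Over a common inner abscissa each edge is weakly above the other, so they meet in an inner
point. -/
theorem upperHullEdge_eq (he : e ∈ A.upperHullEdges) (hf : f ∈ A.upperHullEdges)
    (h1 : e.1 < f.2) (h2 : f.1 < e.2) : e = f := by
  by_contra hne
  obtain ⟨e1, e2⟩ := mem_upperHullEdges.1 he
  obtain ⟨f1, f2⟩ := mem_upperHullEdges.1 hf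
  have hlt : max (A.pt e.1).1 (A.pt f.1).1 < min (A.pt e.2).1 (A.pt f.2).1 :=
    max_lt (lt_min (A.strictMono_fst e1) (A.strictMono_fst h1))
      (lt_min (A.strictMono_fst h2) (A.strictMono_fst f1))
  obtain ⟨x, hx1, hx2⟩ := exists_between hlt
  obtain ⟨x1, x2⟩ := max_lt_iff.1 hx1
  obtain ⟨x3, x4⟩ := lt_min_iff.1 hx2
  have me : (x, A.line e x) ∈ A.seg e := (mem_seg_iff e1).2 ⟨x1.le, x3.le, rfl⟩
  have mf : (x, A.line f x) ∈ A.seg f := (mem_seg_iff f1).2 ⟨x2.le, x4.le, rfl⟩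
  have heq : A.line e x = A.line f x := le_antisymm
    (f2 _ (A.seg_subset_convexHull e me) _ mf rfl) (e2 _ (A.seg_subset_convexHull f mf) _ me rfl)
  exact Set.disjoint_left.1 (disjoint_of_mem_upperHullEdges he f1 hne)
    ((mem_openSegment_iff e1).2 ⟨x1, x3, rfl⟩) ((mem_openSegment_iff f1 (p := (_, _))).2 ⟨x2, x4, heq⟩)

open Classical in
/-- The vertices of the upper hull: the points not strictly spanned by an upper hull edge. -/
noncomputable def upperHullVertices (A : NearEdge n) : Finset (Fin (n + 1)) :=
  Finset.univ.filter fun k => ∀ e ∈ A.upperHullEdges, ¬ (e.1 < k ∧ k < e.2)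

theorem mem_upperHullVertices {k : Fin (n + 1)} :
    k ∈ A.upperHullVertices ↔ ∀ e ∈ A.upperHullEdges, ¬ (e.1 < k ∧ k < e.2) := by
  simp [upperHullVertices]

theorem isMonotonePolyline_upperHullVertices (A : NearEdge n) :
    IsMonotonePolyline A.upperHullVertices :=
  ⟨mem_upperHullVertices.2 fun _ _ h => absurd h.1 (Fin.not_lt_zero _),
    mem_upperHullVertices.2 fun _ _ h => absurd h.2 (not_lt.2 (Fin.le_last _))⟩

theorem polyEdges_upperHullVertices (A : NearEdge n) :
    polyEdges A.upperHullVertices = A.upperHullEdges := by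
  ext e
  constructor
  · intro he
    obtain ⟨h1, h2, h3, h4⟩ := mem_polyEdges.1 he
    -- The hull edge `f` over the gap just right of `e.1` must start at `e.1`, which no hull edge
    -- strictly spans. It ends in a hull vertex, and the only one available is `e.2`.
    obtain ⟨f, hf, f1, f2⟩ := A.exists_upperHullEdge
      ⟨e.1.val, by have := Fin.lt_def.1 h3; omega⟩
    have f1' : f.1 ≤ e.1 := f1
    have f2' : e.1 < f.2 := Fin.castSucc_lt_iff_succ_le.2 f2
    have g1 : f.1 = e.1 := le_antisymm f1' (not_lt.1 fun h =>
      mem_upperHullVertices.1 h1 f hf ⟨h, f2'⟩)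
    have g2 : f.2 ≤ e.2 := not_lt.1 fun h => mem_upperHullVertices.1 h2 f hf ⟨g1 ▸ h3, h⟩
    have g3 : f.2 ∈ A.upperHullVertices := mem_upperHullVertices.2 fun g hg hlt => by
      obtain rfl := upperHullEdge_eq hf hg (f1'.trans_lt (f2'.trans hlt.2)) hlt.1
      exact lt_irrefl _ hlt.2
    have g4 : f.2 = e.2 := le_antisymm g2 (not_lt.1 fun h => h4 _ g3 ⟨f2', h⟩)
    rwa [← Prod.ext g1 g4]
  · intro he
    have hlt := (mem_upperHullEdges.1 he).1
    refine mem_polyEdges.2 ⟨mem_upperHullVertices.2 fun g hg h => ?_,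
      mem_upperHullVertices.2 fun g hg h => ?_, hlt, fun m hm => mem_upperHullVertices.1 hm e he⟩
    · obtain rfl := upperHullEdge_eq he hg h.2 (h.1.trans hlt)
      exact lt_irrefl _ h.1
    · obtain rfl := upperHullEdge_eq he hg (hlt.trans h.2) h.1
      exact lt_irrefl _ h.2

theorem convexHull_liesBelow_carrier (A : NearEdge n) :
    LiesBelow (convexHull ℝ (Set.range A.pt)) (A.carrier A.upperHullVertices) := by
  have key : ∀ e ∈ A.upperHullEdges, ∀ k ∈ A.upperHullVertices, e.1 ≤ k → k ≤ e.2 →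
      A.pt k ∈ A.seg e := by
    intro e he k hk h1 h2
    rcases h1.eq_or_lt with rfl | h1
    · exact left_mem_segment _ _ _
    rcases h2.eq_or_lt with rfl | h2
    · exact right_mem_segment _ _ _
    exact absurd ⟨h1, h2⟩ (mem_upperHullVertices.1 hk e he)
  intro p hp q hq hpq
  rcases mem_carrier.1 hq with ⟨k, hk, rfl⟩ | ⟨e, he, hqe⟩
  -- For `n = 0` there are no hull edges and the hull is a single point; otherwise some hull edge
  -- contains the vertex.
  · cases n with
    | zero =>
      have : convexHull ℝ (Set.range A.pt) ⊆ {A.pt k} :=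
        convexHull_min (by rintro _ ⟨m, rfl⟩; rw [Subsingleton.elim (α := Fin 1) m k]; rfl)
          (convex_singleton _)
      rw [this hp]
    | succ n =>
      obtain ⟨e, he, h1, h2⟩ : ∃ e ∈ A.upperHullEdges, e.1 ≤ k ∧ k ≤ e.2 := by
        cases k using Fin.lastCases with
        | last =>
          obtain ⟨e, he, h1, h2⟩ := A.exists_upperHullEdge (Fin.last n)
          exact ⟨e, he, Fin.le_last _, h2⟩
        | cast k =>
          obtain ⟨e, he, h1, h2⟩ := A.exists_upperHullEdge k
          exact ⟨e, he, h1, Fin.castSucc_lt_succ.le.trans h2⟩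
      exact (mem_upperHullEdges.1 he).2 p hp _ (key e he k hk h1 h2) hpq
  · rw [polyEdges_upperHullVertices] at he
    exact (mem_upperHullEdges.1 he).2 p hp q (openSegment_subset_segment _ _ _ hqe) hpq

theorem upperHullVertices_subset (hU : IsMonotonePolyline U)
    (h : LiesBelow (Set.range A.pt) (A.carrier U)) : A.upperHullVertices ⊆ U := by
  intro k hk
  by_contra hkU
  obtain ⟨f, hf, f1, f2⟩ := exists_polyEdge hU hkU
  obtain ⟨q, hq, hqk⟩ := A.exists_mem_seg f1 f2
  have a1 := h _ ⟨k, rfl⟩ q (seg_subset_carrier hf hq) hqk.symm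
  have a2 := A.convexHull_liesBelow_carrier q (A.seg_subset_convexHull f hq) _
    (Or.inl ⟨k, hk, rfl⟩) hqk
  exact A.pt_notMem_seg f1 f2 (Prod.ext hqk (le_antisymm a2 a1) ▸ hq)

theorem eq_upperHullVertices (hU : IsMonotonePolyline U)
    (h : LiesBelow (Set.range A.pt) (A.carrier U))
    (hcard : (polyEdges U).card = A.upperHullEdges.card) : U = A.upperHullVertices := by
  refine (Finset.eq_of_subset_of_card_le (upperHullVertices_subset hU h) ?_).symm
  rw [← card_polyEdges hU, hcard, ← card_polyEdges A.isMonotonePolyline_upperHullVertices,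
    polyEdges_upperHullVertices]

theorem carrier_liesBelow_convexHull (A : NearEdge n) :
    LiesBelow (A.carrier A.flip.upperHullVertices) (convexHull ℝ (Set.range A.pt)) := by
  simpa only [convexHull_flip, carrier_flip, liesBelow_reflect] using
    A.flip.convexHull_liesBelow_carrier

theorem LiesBelow.mono {X X' Y Y' : Set (ℝ × ℝ)} (h : LiesBelow X Y) (hX : X' ⊆ X)
    (hY : Y' ⊆ Y) : LiesBelow X' Y' := fun p hp q hq => h p (hX hp) q (hY hq)

theorem edgesBetween_hull (A : NearEdge n) :
    A.edgesBetween A.upperHullVertices A.flip.upperHullVertices = allEdges n := by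
  ext e
  rw [mem_edgesBetween, and_iff_left]
  exact ⟨LiesBelow.mono A.carrier_liesBelow_convexHull subset_rfl (A.seg_subset_convexHull e),
    LiesBelow.mono A.convexHull_liesBelow_carrier (A.seg_subset_convexHull e) subset_rfl⟩

theorem IsTriangulation.upperHullEdges_subset (h : A.IsTriangulation T) :
    A.upperHullEdges ⊆ T := fun _ he =>
  mem_of_maximal h (mem_allEdges.2 (mem_upperHullEdges.1 he).1) fun _ hf hne =>
    disjoint_of_mem_upperHullEdges he (mem_allEdges.1 (h.prop.1 hf)) hne

theorem IsTriangulation.flip (h : A.IsTriangulation T) : A.flip.IsTriangulation T :=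
  IsTriangulation.of_flip (by rwa [flip_flip])

/-- Triangulations are the partial triangulations between the lower and the upper hull. -/
theorem isTriangulation_iff : A.IsTriangulation T ↔
    A.IsPartialTriangulation A.upperHullVertices A.flip.upperHullVertices T := by
  constructor
  · intro h
    exact
      { roof_monotone := A.isMonotonePolyline_upperHullVertices
        floor_monotone := A.flip.isMonotonePolyline_upperHullVertices
        floor_below_roof := LiesBelow.mono A.convexHull_liesBelow_carrier
          (A.carrier_subset_convexHull _) subset_rfl
        below_roof := LiesBelow.mono A.convexHull_liesBelow_carrier
          (subset_convexHull ℝ _) subset_rfl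
        above_floor := LiesBelow.mono A.carrier_liesBelow_convexHull subset_rfl
          (subset_convexHull ℝ _)
        roof_subset := by
          rw [polyEdges_upperHullVertices]
          exact h.upperHullEdges_subset
        floor_subset := by
          rw [polyEdges_upperHullVertices]
          exact h.flip.upperHullEdges_subset
        maximal := by
          rw [edgesBetween_hull]
          exact h }
  · intro h
    have := h.maximal
    rwa [edgesBetween_hull] at this

theorem IsPartialTriangulation.eq_hull (h : A.IsPartialTriangulation U L T)
    (hU : (polyEdges U).card = A.upperHullEdges.card)
    (hL : (polyEdges L).card = A.lowerHullEdges.card) :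
    U = A.upperHullVertices ∧ L = A.flip.upperHullVertices :=
  ⟨eq_upperHullVertices h.roof_monotone h.below_roof hU,
    eq_upperHullVertices h.floor_monotone h.flip.below_roof (by rw [hL, upperHullEdges_flip])⟩

/-! ### The number of triangulations as a coefficient -/

theorem coeff_X_pow_mul_X_pow (a b i j : ℕ) :
    MvPolynomial.coeff (Finsupp.single (0 : Fin 2) i + Finsupp.single 1 j)
      (MvPolynomial.X 0 ^ a * MvPolynomial.X 1 ^ b : MvPolynomial (Fin 2) ℚ) =
      if a = i ∧ b = j then 1 else 0 := by
  rw [MvPolynomial.X_pow_eq_monomial, MvPolynomial.X_pow_eq_monomial, MvPolynomial.monomial_mul,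
    MvPolynomial.coeff_monomial, one_mul]
  congr 1
  rw [eq_iff_iff, Finsupp.ext_iff, Fin.forall_fin_two]
  simp

theorem numTriangulations_eq_coeff (A : NearEdge n) :
    (A.numTriangulations : ℚ) = MvPolynomial.coeff
      (Finsupp.single 0 A.upperHullEdges.card + Finsupp.single 1 A.lowerHullEdges.card)
      A.jointPoly := by
  classical
  rw [jointPoly, MvPolynomial.coeff_sum]
  simp only [coeff_X_pow_mul_X_pow]
  rw [Finset.sum_boole, Finset.filter_filter, numTriangulations, Nat.cast_inj,
    Set.ncard_eq_toFinset_card']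
  refine Finset.card_nbij (fun T => (T, A.upperHullVertices, A.flip.upperHullVertices)) ?_ ?_ ?_
  · intro T hT
    rw [Finset.mem_coe, Set.mem_toFinset] at hT
    refine Finset.mem_filter.2 ⟨Finset.mem_univ _, isTriangulation_iff.1 hT, ?_, ?_⟩
    · simp only [polyEdges_upperHullVertices]
    · simp only [polyEdges_upperHullVertices, upperHullEdges_flip]
  · intro T _ T' _ h
    exact (Prod.ext_iff.1 h).1
  -- The numbers of segments force roof and floor to be the hulls, so only `T` is free.
  · rintro ⟨T, U, L⟩ h
    obtain ⟨-, h, hU, hL⟩ := Finset.mem_filter.1 h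
    obtain ⟨rfl, rfl⟩ := h.eq_hull hU hL
    refine ⟨T, ?_, rfl⟩
    rw [Finset.mem_coe, Set.mem_toFinset]
    exact isTriangulation_iff.2 h

/-! ### Chains -/

/-- In a chain no edge crosses the polyline through all points. -/
theorem IsChain.disjoint (hA : A.IsChain) {c : Fin (n + 1) × Fin (n + 1)}
    (hc : c ∈ polyEdges Finset.univ) (he : e.1 < e.2) (hne : e ≠ c) :
    Disjoint (openSegment ℝ (A.pt e.1) (A.pt e.2)) (openSegment ℝ (A.pt c.1) (A.pt c.2)) := by
  obtain ⟨k, rfl⟩ := mem_polyEdges_univ.1 hc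
  -- The singleton `{e}` extends to a triangulation, which also contains `c` because `A` is a chain.
  have hS : ({e} : Finset _) ⊆ allEdges n ∧ A.NonCrossing {e} := by
    refine ⟨Finset.singleton_subset_iff.2 (mem_allEdges.2 he), fun a ha b hb hab => ?_⟩
    rw [Finset.mem_singleton] at ha hb
    exact absurd (ha.trans hb.symm) hab
  obtain ⟨T, hT, hmax⟩ := Finite.exists_le_maximal
    (p := fun S => S ⊆ allEdges n ∧ A.NonCrossing S) hS
  exact hmax.prop.2 e (hT (Finset.mem_singleton_self e)) _ (hA k T hmax) hne

/-- If two neighbours were on different sides of `e`, then `e` would cross the segment joining them.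
-/
theorem IsChain.pt_lt_line_iff (hA : A.IsChain) {k : Fin n} (h1 : e.1 < k.castSucc)
    (h2 : k.succ < e.2) : (A.pt k.castSucc).2 < A.line e (A.pt k.castSucc).1 ↔
      (A.pt k.succ).2 < A.line e (A.pt k.succ).1 := by
  have hk : k.castSucc < k.succ := Fin.castSucc_lt_succ
  have he : e.1 < e.2 := (h1.trans hk).trans h2
  by_contra hiff
  have n1 := pt_snd_ne_line (A := A) h1 (hk.trans h2)
  have n2 := pt_snd_ne_line (A := A) (h1.trans hk) h2
  obtain ⟨α, β, hd⟩ := A.exists_line_sub_line e (k.castSucc, k.succ)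
  have d1 := hd (A.pt k.castSucc).1
  have d2 := hd (A.pt k.succ).1
  have l1 : A.line (k.castSucc, k.succ) (A.pt k.castSucc).1 = (A.pt k.castSucc).2 := line_fst
  have l2 : A.line (k.castSucc, k.succ) (A.pt k.succ).1 = (A.pt k.succ).2 :=
    line_snd (e := (k.castSucc, k.succ)) hk
  rw [l1] at d1
  rw [l2] at d2
  have hneg : (α + β * (A.pt k.castSucc).1) * (α + β * (A.pt k.succ).1) < 0 := by
    rw [← d1, ← d2]
    rcases n1.lt_or_gt with g1 | g1 <;> rcases n2.lt_or_gt with g2 | g2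
    · exact absurd (iff_of_true g1 g2) hiff
    · exact mul_neg_of_pos_of_neg (sub_pos.2 g1) (sub_neg.2 g2)
    · exact mul_neg_of_neg_of_pos (sub_neg.2 g1) (sub_pos.2 g2)
    · exact absurd (iff_of_false g1.not_gt g2.not_gt) hiff
  obtain ⟨x, x1, x2, hx⟩ := exists_affine_zero (A.strictMono_fst hk) hneg
  have hx' : A.line e x = A.line (k.castSucc, k.succ) x := by linarith [hd x]
  have hdisj := hA.disjoint (e := e) (mem_polyEdges_univ.2 ⟨k, rfl⟩) he fun h => ?_
  · refine Set.disjoint_left.1 hdisj ((mem_openSegment_iff he (p := (x, A.line e x))).2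
      ⟨(A.strictMono_fst h1).trans x1, x2.trans (A.strictMono_fst h2), rfl⟩) ?_
    exact (mem_openSegment_iff (e := (k.castSucc, k.succ)) hk (p := (_, _))).2 ⟨x1, x2, hx'⟩
  · rw [h] at h1
    exact lt_irrefl _ h1

theorem IsChain.pt_lt_line_iff_of_le (hA : A.IsChain) {k m : Fin (n + 1)} (h1 : e.1 < k)
    (hkm : k ≤ m) (h2 : m < e.2) :
    (A.pt k).2 < A.line e (A.pt k).1 ↔ (A.pt m).2 < A.line e (A.pt m).1 := by
  induction m using Fin.induction with
  | zero => rw [Fin.le_zero_iff.1 hkm]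
  | succ i ih =>
    rcases hkm.eq_or_lt with rfl | hlt
    · rfl
    · have hki : k ≤ i.castSucc := Fin.le_castSucc_iff.2 hlt
      exact (ih hki (Fin.castSucc_lt_succ.trans h2)).trans
        (hA.pt_lt_line_iff (h1.trans_le hki) h2)

theorem seg_liesBelow_carrier_univ (hf : f.1 < f.2)
    (h : ∀ k, f.1 ≤ k → k ≤ f.2 → A.line f (A.pt k).1 ≤ (A.pt k).2) :
    LiesBelow (A.seg f) (A.carrier Finset.univ) := by
  rw [← liesBelow_reflect, ← carrier_flip, ← seg_flip]
  refine carrier_univ_liesBelow_seg hf fun k h1 h2 => ?_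
  have : A.flip.line f (A.flip.pt k).1 = - A.line f (A.pt k).1 := by
    simp only [line, flip_pt, reflect_apply]
    ring
  rw [this]
  exact neg_le_neg (h k h1 h2)

/-- In a chain each edge lies above or below the polyline through all points. -/
theorem IsChain.liesBelow_or (hA : A.IsChain) (he : e.1 < e.2) :
    LiesBelow (A.carrier Finset.univ) (A.seg e) ∨
      LiesBelow (A.seg e) (A.carrier Finset.univ) := by
  by_cases h : ∀ k, e.1 < k → k < e.2 → (A.pt k).2 < A.line e (A.pt k).1
  · refine Or.inl (carrier_univ_liesBelow_seg he fun k h1 h2 => ?_)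
    rcases h1.eq_or_lt with rfl | h1
    · rw [line_fst]
    rcases h2.eq_or_lt with rfl | h2
    · rw [line_snd he]
    exact (h k h1 h2).le
  -- All points strictly spanned by `e` are on the same side of it, so the single point `m` decides
  -- for all.
  · push Not at h
    obtain ⟨m, m1, m2, hm⟩ := h
    refine Or.inr (seg_liesBelow_carrier_univ he fun k h1 h2 => ?_)
    rcases h1.eq_or_lt with rfl | h1
    · rw [line_fst]
    rcases h2.eq_or_lt with rfl | h2
    · rw [line_snd he]
    refine not_lt.1 fun hlt => hm.not_gt ?_
    rcases le_total k m with hkm | hkm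
    · exact (hA.pt_lt_line_iff_of_le h1 hkm m2).1 hlt
    · exact (hA.pt_lt_line_iff_of_le m1 hkm h2).2 hlt

/-- In a chain, an edge above the polyline through all points does not cross one below it. -/
theorem IsChain.disjoint_of_separated (hA : A.IsChain) (he : e.1 < e.2) (hf : f.1 < f.2)
    (he' : LiesBelow (A.carrier Finset.univ) (A.seg e))
    (hf' : LiesBelow (A.seg f) (A.carrier Finset.univ)) (hne : e ≠ f) :
    Disjoint (openSegment ℝ (A.pt e.1) (A.pt e.2)) (openSegment ℝ (A.pt f.1) (A.pt f.2)) := by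
  refine Set.disjoint_left.2 fun p hpe hpf => ?_
  have he1 := openSegment_subset_segment _ _ _ hpe
  have hf1 := openSegment_subset_segment _ _ _ hpf
  obtain ⟨r1, r2⟩ := range_seg he he1
  obtain ⟨q, hq, hqp⟩ := exists_mem_carrier (A := A) isMonotonePolyline_univ r1 r2
  -- A common point is squeezed onto the polyline. It is not a vertex, by general position; inside a
  -- segment `c` it would force both edges to equal `c`.
  obtain rfl : q = p :=
    Prod.ext hqp (le_antisymm (he' q hq p he1 hqp) (hf' p hf1 q hq hqp.symm))
  rcases mem_carrier.1 hq with ⟨k, -, rfl⟩ | ⟨c, hc, hqc⟩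
  · have h := (mem_openSegment_iff he).1 hpe
    exact A.pt_notMem_seg (fst_lt_fst_iff.1 h.1) (fst_lt_fst_iff.1 h.2.1) he1
  · have h1 : e = c := by_contra fun h =>
      Set.disjoint_left.1 (hA.disjoint hc he h) hpe hqc
    have h2 : f = c := by_contra fun h =>
      Set.disjoint_left.1 (hA.disjoint hc hf h) hpf hqc
    exact hne (h1.trans h2.symm)

/-! ### Cutting and gluing along the polyline through all points -/

theorem carrier_univ_liesBelow_range (A : NearEdge n) :
    LiesBelow (A.carrier Finset.univ) (Set.range A.pt) :=
  LiesBelow.mono carrier_liesBelow_self subset_rfl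
    (by rintro _ ⟨k, rfl⟩; exact Or.inl ⟨k, by simp, rfl⟩)

theorem carrier_liesBelow_carrier_univ (h : LiesBelow (A.carrier L) (Set.range A.pt)) :
    LiesBelow (A.carrier L) (A.carrier Finset.univ) := by
  rw [← liesBelow_reflect, ← carrier_flip, ← carrier_flip]
  refine carrier_univ_liesBelow_carrier ?_
  rwa [carrier_flip, range_flip_pt, liesBelow_reflect]

theorem edgesBetween_univ_right_subset (h : LiesBelow (A.carrier L) (Set.range A.pt)) :
    A.edgesBetween U Finset.univ ⊆ A.edgesBetween U L := by
  intro e he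
  obtain ⟨h1, h2, h3⟩ := mem_edgesBetween.1 he
  exact mem_edgesBetween.2 ⟨h1, LiesBelow.trans_carrier isMonotonePolyline_univ
    (carrier_liesBelow_carrier_univ h) h2 fun _ => range_carrier, h3⟩

theorem edgesBetween_univ_left_subset (h : LiesBelow (Set.range A.pt) (A.carrier U)) :
    A.edgesBetween Finset.univ L ⊆ A.edgesBetween U L := by
  intro e he
  obtain ⟨h1, h2, h3⟩ := mem_edgesBetween.1 he
  exact mem_edgesBetween.2 ⟨h1, h2, LiesBelow.trans_carrier isMonotonePolyline_univ h3
    (carrier_univ_liesBelow_carrier h) fun _ => range_seg (mem_allEdges.1 h1)⟩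

theorem IsChain.edgesBetween_cases (hA : A.IsChain) (he : e ∈ A.edgesBetween U L) :
    e ∈ A.edgesBetween U Finset.univ ∨ e ∈ A.edgesBetween Finset.univ L := by
  obtain ⟨h1, h2, h3⟩ := mem_edgesBetween.1 he
  exact (hA.liesBelow_or (mem_allEdges.1 h1)).imp (fun h => mem_edgesBetween.2 ⟨h1, h, h3⟩)
    fun h => mem_edgesBetween.2 ⟨h1, h2, h⟩

theorem IsChain.disjoint_of_mem_edgesBetween (hA : A.IsChain)
    (he : e ∈ A.edgesBetween U Finset.univ) (hf : f ∈ A.edgesBetween Finset.univ L)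
    (hne : e ≠ f) :
    Disjoint (openSegment ℝ (A.pt e.1) (A.pt e.2)) (openSegment ℝ (A.pt f.1) (A.pt f.2)) := by
  obtain ⟨e1, e2, -⟩ := mem_edgesBetween.1 he
  obtain ⟨f1, -, f2⟩ := mem_edgesBetween.1 hf
  exact hA.disjoint_of_separated (mem_allEdges.1 e1) (mem_allEdges.1 f1) e2 f2 hne

/-- The part of a partial triangulation of a chain above the polyline through all points. -/
theorem IsPartialTriangulation.upper (h : A.IsPartialTriangulation U L T) (hA : A.IsChain) :
    A.IsPartialTriangulation U Finset.univ (T ∩ A.edgesBetween U Finset.univ) := by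
  have hU := carrier_univ_liesBelow_carrier h.below_roof
  have hsub := edgesBetween_univ_right_subset (U := U) h.above_floor
  have mem_of_poly : ∀ c ∈ polyEdges Finset.univ, c ∈ A.edgesBetween U Finset.univ := by
    intro c hc
    exact mem_edgesBetween.2 ⟨mem_allEdges.2 (lt_of_mem_polyEdges hc),
      LiesBelow.mono carrier_liesBelow_self subset_rfl (seg_subset_carrier hc),
      LiesBelow.mono hU (seg_subset_carrier hc) subset_rfl⟩
  refine
    { roof_monotone := h.roof_monotone
      floor_monotone := isMonotonePolyline_univ
      floor_below_roof := hU
      below_roof := h.below_roof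
      above_floor := A.carrier_univ_liesBelow_range
      roof_subset := fun e he => Finset.mem_inter.2 ⟨h.roof_subset he, mem_edgesBetween.2
        ⟨mem_allEdges.2 (lt_of_mem_polyEdges he),
          LiesBelow.mono hU subset_rfl (seg_subset_carrier he),
          LiesBelow.mono carrier_liesBelow_self (seg_subset_carrier he) subset_rfl⟩⟩
      floor_subset := fun c hc => Finset.mem_inter.2 ⟨?_, mem_of_poly c hc⟩
      maximal := ⟨⟨Finset.inter_subset_right, fun e he f hf =>
        h.maximal.prop.2 e (Finset.mem_inter.1 he).1 f (Finset.mem_inter.1 hf).1⟩, ?_⟩ }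
  · exact mem_of_maximal h.maximal (hsub (mem_of_poly c hc)) fun f hf hne =>
      (hA.disjoint hc (mem_allEdges.1 (mem_edgesBetween.1 (h.maximal.prop.1 hf)).1)
        hne.symm).symm
  -- The new edge `e` crosses no upper edge of `T`, since these lie in `S`, and no lower edge, since
  -- `A` is a chain; so maximality of `T` applies.
  · rintro S ⟨hS, hS'⟩ hle e he
    refine Finset.mem_inter.2 ⟨mem_of_maximal h.maximal (hsub (hS he)) fun f hf hne => ?_, hS he⟩
    rcases hA.edgesBetween_cases (h.maximal.prop.1 hf) with hf' | hf'
    · exact hS' e he f (hle (Finset.mem_inter.2 ⟨hf, hf'⟩)) hne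
    · exact hA.disjoint_of_mem_edgesBetween (hS he) hf' hne

/-- The part of a partial triangulation of a chain below the polyline through all points. -/
theorem IsPartialTriangulation.lower (h : A.IsPartialTriangulation U L T) (hA : A.IsChain) :
    A.IsPartialTriangulation Finset.univ L (T ∩ A.edgesBetween Finset.univ L) := by
  have := h.flip.upper hA.flip
  rwa [edgesBetween_flip, isPartialTriangulation_flip] at this

/-- An upper and a lower partial triangulation of a chain fit together. -/
theorem IsPartialTriangulation.union {T' : Finset (Fin (n + 1) × Fin (n + 1))}
    (h : A.IsPartialTriangulation U Finset.univ T)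
    (h' : A.IsPartialTriangulation Finset.univ L T') (hA : A.IsChain) :
    A.IsPartialTriangulation U L (T ∪ T') where
  roof_monotone := h.roof_monotone
  floor_monotone := h'.floor_monotone
  floor_below_roof := LiesBelow.trans_carrier isMonotonePolyline_univ h'.floor_below_roof
    h.floor_below_roof fun _ => range_carrier
  below_roof := h.below_roof
  above_floor := h'.above_floor
  roof_subset := h.roof_subset.trans Finset.subset_union_left
  floor_subset := h'.floor_subset.trans Finset.subset_union_right
  maximal := by
    refine ⟨⟨Finset.union_subset
      (h.maximal.prop.1.trans (edgesBetween_univ_right_subset h'.above_floor))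
      (h'.maximal.prop.1.trans (edgesBetween_univ_left_subset h.below_roof)), ?_⟩, ?_⟩
    · intro e he f hf hne
      rcases Finset.mem_union.1 he with he | he <;> rcases Finset.mem_union.1 hf with hf | hf
      · exact h.maximal.prop.2 e he f hf hne
      · exact hA.disjoint_of_mem_edgesBetween (h.maximal.prop.1 he) (h'.maximal.prop.1 hf) hne
      · exact (hA.disjoint_of_mem_edgesBetween (h.maximal.prop.1 hf) (h'.maximal.prop.1 he)
          hne.symm).symm
      · exact h'.maximal.prop.2 e he f hf hne
    · rintro S ⟨hS, hS'⟩ hle e he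
      rcases hA.edgesBetween_cases (hS he) with he' | he'
      · exact Finset.mem_union_left _ (mem_of_maximal h.maximal he' fun f hf =>
          hS' e he f (hle (Finset.mem_union_left _ hf)))
      · exact Finset.mem_union_right _ (mem_of_maximal h'.maximal he' fun f hf =>
          hS' e he f (hle (Finset.mem_union_right _ hf)))

/-- The halves overlap, for instance in the segments of the polyline. An edge of `T'` in the upper
region crosses nothing in `T`, so by maximality it is already in `T`. -/
theorem IsPartialTriangulation.union_inter_upper {T' : Finset (Fin (n + 1) × Fin (n + 1))}
    (h : A.IsPartialTriangulation U Finset.univ T)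
    (h' : A.IsPartialTriangulation Finset.univ L T') (hA : A.IsChain) :
    (T ∪ T') ∩ A.edgesBetween U Finset.univ = T := by
  refine ((Finset.subset_inter Finset.subset_union_left h.maximal.prop.1).antisymm ?_).symm
  intro e he
  obtain ⟨he, heU⟩ := Finset.mem_inter.1 he
  rcases Finset.mem_union.1 he with he | he
  · exact he
  · exact mem_of_maximal h.maximal heU fun f hf hne =>
      (hA.disjoint_of_mem_edgesBetween (h.maximal.prop.1 hf) (h'.maximal.prop.1 he)
        hne.symm).symm

theorem IsPartialTriangulation.union_inter_lower {T' : Finset (Fin (n + 1) × Fin (n + 1))}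
    (h : A.IsPartialTriangulation U Finset.univ T)
    (h' : A.IsPartialTriangulation Finset.univ L T') (hA : A.IsChain) :
    (T ∪ T') ∩ A.edgesBetween Finset.univ L = T' := by
  have := h'.flip.union_inter_upper h.flip hA.flip
  rwa [edgesBetween_flip, Finset.union_comm] at this

theorem IsPartialTriangulation.upper_union_lower (h : A.IsPartialTriangulation U L T)
    (hA : A.IsChain) :
    T ∩ A.edgesBetween U Finset.univ ∪ T ∩ A.edgesBetween Finset.univ L = T := by
  rw [← Finset.inter_union_distrib_left, Finset.inter_eq_left]
  exact fun e he => Finset.mem_union.2 (hA.edgesBetween_cases (h.maximal.prop.1 he))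

theorem IsChain.jointPoly_eq (hA : A.IsChain) : A.jointPoly =
    Polynomial.aeval (MvPolynomial.X 0) A.upperPoly *
      Polynomial.aeval (MvPolynomial.X 1) A.lowerPoly := by
  classical
  rw [lowerPoly, upperPoly, upperPoly, map_sum, map_sum, Finset.sum_mul_sum,
    ← Finset.sum_product']
  -- Reflection turns the terms of `lowerPoly` into partial triangulations of `A` whose roof is the
  -- polyline through all points.
  simp only [map_pow, Polynomial.aeval_X, isPartialTriangulation_flip, jointPoly]
  refine Finset.sum_nbij' (fun p => ((p.1 ∩ A.edgesBetween p.2.1 Finset.univ, p.2.1),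
    (p.1 ∩ A.edgesBetween Finset.univ p.2.2, p.2.2))) (fun q => (q.1.1 ∪ q.2.1, q.1.2, q.2.2))
    ?_ ?_ ?_ ?_ ?_
  · rintro ⟨T, U, L⟩ hp
    have h := (Finset.mem_filter.1 hp).2
    exact Finset.mem_product.2 ⟨Finset.mem_filter.2 ⟨Finset.mem_univ _, h.upper hA⟩,
      Finset.mem_filter.2 ⟨Finset.mem_univ _, h.lower hA⟩⟩
  · rintro ⟨⟨T, U⟩, T', L⟩ hq
    obtain ⟨h, h'⟩ := Finset.mem_product.1 hq
    exact Finset.mem_filter.2 ⟨Finset.mem_univ _,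
      (Finset.mem_filter.1 h).2.union (Finset.mem_filter.1 h').2 hA⟩
  · rintro ⟨T, U, L⟩ hp
    exact Prod.ext ((Finset.mem_filter.1 hp).2.upper_union_lower hA) rfl
  · rintro ⟨⟨T, U⟩, T', L⟩ hq
    obtain ⟨h, h'⟩ := Finset.mem_product.1 hq
    exact Prod.ext
      (Prod.ext ((Finset.mem_filter.1 h).2.union_inter_upper (Finset.mem_filter.1 h').2 hA) rfl)
      (Prod.ext ((Finset.mem_filter.1 h).2.union_inter_lower (Finset.mem_filter.1 h').2 hA) rfl)
  · intros
    rfl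

/-- Both sides are bilinear in `p` and `q`, so monomials suffice. -/
theorem coeff_aeval_mul_aeval (p q : Polynomial ℚ) (i j : ℕ) :
    MvPolynomial.coeff (Finsupp.single (0 : Fin 2) i + Finsupp.single 1 j)
      (Polynomial.aeval (MvPolynomial.X 0) p * Polynomial.aeval (MvPolynomial.X 1) q :
        MvPolynomial (Fin 2) ℚ) = p.coeff i * q.coeff j := by
  induction p using Polynomial.induction_on' with
  | add p p' hp hp' => rw [map_add, add_mul, MvPolynomial.coeff_add, hp, hp',
      Polynomial.coeff_add, add_mul]
  | monomial a r =>
    induction q using Polynomial.induction_on' with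
    | add q q' hq hq' => rw [map_add, mul_add, MvPolynomial.coeff_add, hq, hq',
        Polynomial.coeff_add, mul_add]
    | monomial b s =>
      rw [Polynomial.aeval_monomial, Polynomial.aeval_monomial, mul_mul_mul_comm, ← map_mul,
        MvPolynomial.algebraMap_eq, MvPolynomial.coeff_C_mul, coeff_X_pow_mul_X_pow,
        Polynomial.coeff_monomial, Polynomial.coeff_monomial]
      split_ifs <;> simp_all

end NearEdge

theorem mainTheorem3 (n : ℕ) (A : NearEdge n) (i j : ℕ)
    (hi : A.upperHullEdges.card = i) (hj : A.lowerHullEdges.card = j) :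
    (A.numTriangulations : ℚ) =
        MvPolynomial.coeff (Finsupp.single 0 i + Finsupp.single 1 j) A.jointPoly ∧
      (A.IsChain →
        A.jointPoly =
            Polynomial.aeval (MvPolynomial.X 0) A.upperPoly *
              Polynomial.aeval (MvPolynomial.X 1) A.lowerPoly ∧
          (A.numTriangulations : ℚ) = A.upperPoly.coeff i * A.lowerPoly.coeff j) := by
  subst hi hj
  refine ⟨A.numTriangulations_eq_coeff, fun hA => ⟨hA.jointPoly_eq, ?_⟩⟩
  rw [A.numTriangulations_eq_coeff, hA.jointPoly_eq, NearEdge.coeff_aeval_mul_aeval]
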